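/- Let $\|\cdot\|$ be an arbitrary norm on $\mathbb R^n$ with dual norm $\|\alpha\|_*=\sup\{y^\top\alpha:\|y\|\le 1\}$, and for Borel probability measures on $\mathbb R^n$ let $\mathcal W(\mathbb Q_1,\mathbb Q_2)=\inf_\pi \int\|y_1-y_2\|\,d\pi$ over all couplings $\pi$ of $\mathbb Q_1,\mathbb Q_2$, and $\mathbb B_\delta(\mathbb P)=\{\mathbb Q:\mathcal W(\mathbb Q,\mathbb P)\le\delta\}$ (empty for $\delta<0$). Let $\hat y_1,\dots,\hat y_N\in\mathbb R^n$, let $\mathcal A\subseteq\mathbb R^n$ be a set of decisions, and let $\mathcal V$ be a convex set of pairs $(p,\delta)\in\mathbb R^N\times\mathbb R$ with $p_i\ge 0$ and $\sum_i p_i=1$; put $\mathcal V_+=\{(p,\delta)\in\mathcal V:\delta\ge 0\}$ and $\mathcal P=\bigcup_{(p,\delta)\in\mathcal V}\mathbb B_\delta\big(\sum_{i=1}^N p_i\mathrm I_{\hat y_i}\big)$, where $\mathrm I_y$ is the unit point mass at $y$. Let $u:\mathbb R\to\mathbb R$ be convex, increasing (nondecreasing) and Lipschitz with smallest Lipschitz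 constant $\mathrm{Lip}(u)$, let $l$ lie in the interior of the range of $u$, and let $$\rho_{\mathbb Q}(Z)=\inf\{\kappa\in\mathbb R:\mathbb E_{\mathbb Q}[u(-Z-\kappa)]\le l\}$$ be the utility-based shortfall risk measure. Let $\sigma^*(v\mid\mathcal V_+)=\sup_{(p,\delta)\in\mathcal V_+}v^\top(p,\delta)$, $v\in\mathbb R^{N+1}$, be the convex conjugate of the indicator function of $\mathcal V_+$ ($0$ on $\mathcal V_+$, $+\infty$ elsewhere). Optimal values are taken in $[-\infty,\infty]$, with $\inf\emptyset=+\infty$ and $\sup\emptyset=-\infty$. Then the following four optimal values are equal: 1. $\displaystyle\inf_{\alpha\in\mathcal A}\ \sup_{\mathbb Q\in\mathcal P}\rho_{\mathbb Q}(Y^\top\alpha)$; 2. $\displaystyle\inf_{\alpha\in\mathcal A}\ \sup_{(p,\delta)\in\mathcal V_+}\ \inf\Big\{\kappa\in\mathbb R:\ \sum_{i=1}^N p_iu(-\hat y_i^\top\alpha-\kappa)+\mathrm{Lip}(u)\,\delta\,\|\alpha\|_*\le l\Big\}$; 3. $\displaystyle\inf_{\alpha\in\mathcal A,\ \kappa\in\mathbb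 R}\kappa$ subject to $\sum_{i=1}^N p_iu(-\hat y_i^\top\alpha-\kappa)+\mathrm{Lip}(u)\,\delta\,\|\alpha\|_*\le l$ for all $(p,\delta)\in\mathcal V_+$; 4. $\displaystyle\inf_{\alpha\in\mathcal A,\ \kappa\in\mathbb R,\ v\in\mathbb R^{N+1}}\kappa$ subject to $\sigma^*(v\mid\mathcal V_+)\le l$, $\ v_i\ge u(-\hat y_i^\top\alpha-\kappa)$ for $i=1,\dots,N$, and $v_{N+1}\ge\mathrm{Lip}(u)\|\alpha\|_*$. The problems are moreover equivalent decision by decision: for each $\alpha\in\mathcal A$ the inner suprema in 1 and 2 agree; $(\alpha,\kappa)$ is feasible in 3 if and only if $\alpha\in\mathcal A$ and $\sup_{\mathbb Q\in\mathcal P}\rho_{\mathbb Q}(Y^\top\alpha)\le\kappa$; and $(\alpha,\kappa)$ is feasible in 3 if and only if $(\alpha,\kappa,v)$ is feasible in 4 for some $v$. If $\mathcal A$ is convex, then the feasible set of 4 is convex, so that 4 is a convex program. -/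

import Mathlib

namespace UnionBall

/-- The smallest Lipschitz constant `Lip(u)` of a Lipschitz function `u : ℝ → ℝ`. -/
noncomputable def lipConst (u : ℝ → ℝ) : ℝ :=
  sInf {L : ℝ | 0 ≤ L ∧ ∀ x y : ℝ, |u x - u y| ≤ L * |x - y|}

/-- The dual norm `‖α‖_* = sup {yᵀα : ‖y‖ ≤ 1}` of a norm on `ℝⁿ`. -/
noncomputable def dualNorm {n : ℕ} (nrm : Seminorm ℝ (Fin n → ℝ)) (α : Fin n → ℝ) : ℝ :=
  sSup {r : ℝ | ∃ y : Fin n → ℝ, nrm y ≤ 1 ∧ r = dotProduct y α}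

/-- The optimal transport cost between `Q₁` and `Q₂` for the ground cost `D`:
the infimum over all couplings `π` of the expectation of `D` under `π`. -/
noncomputable def otCost {E : Type*} [MeasurableSpace E] (D : E → E → ℝ)
    (Q₁ Q₂ : MeasureTheory.Measure E) : ENNReal :=
  ⨅ (π : MeasureTheory.Measure (E × E))
    (_ : π.map Prod.fst = Q₁ ∧ π.map Prod.snd = Q₂),
    MeasureTheory.lintegral π (fun z => ENNReal.ofReal (D z.1 z.2))

/-- The ball of radius `δ` around `P` for the optimal transport cost; it is empty if `δ < 0`. -/
def otBall {E : Type*} [MeasurableSpace E] (D : E → E → ℝ)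
    (P : MeasureTheory.Measure E) (δ : ℝ) : Set (MeasureTheory.Measure E) :=
  {Q | MeasureTheory.IsProbabilityMeasure Q ∧ ((otCost D Q P : ENNReal) : EReal) ≤ (δ : EReal)}

/-- The discrete measure with mass `p i` at `yhat i`. -/
noncomputable def center {n N : ℕ} (yhat : Fin N → Fin n → ℝ) (p : Fin N → ℝ) :
    MeasureTheory.Measure (Fin n → ℝ) :=
  ∑ i, ENNReal.ofReal (p i) • MeasureTheory.Measure.dirac (yhat i)

/-- The union of the balls (cost `‖y₁ - y₂‖`) of radius `δ` around `∑ i, p i • I_{yhat i}`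
over all `(p, δ) ∈ V`. -/
def unionBall {n N : ℕ} (nrm : Seminorm ℝ (Fin n → ℝ)) (yhat : Fin N → Fin n → ℝ)
    (V : Set ((Fin N → ℝ) × ℝ)) : Set (MeasureTheory.Measure (Fin n → ℝ)) :=
  ⋃ x ∈ V, otBall (fun y₁ y₂ => nrm (y₁ - y₂)) (center yhat x.1) x.2

/-- The utility-based shortfall risk of the random variable `Z` under `Q`:
`inf {κ ∈ ℝ : E_Q[u(-Z-κ)] ≤ l}`, the expectation being required to exist. -/
noncomputable def shortfall {Ω : Type*} [MeasurableSpace Ω] (u : ℝ → ℝ) (l : ℝ)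
    (Q : MeasureTheory.Measure Ω) (Z : Ω → ℝ) : EReal :=
  ⨅ (κ : ℝ) (_ : MeasureTheory.Integrable (fun ω => u (-(Z ω) - κ)) Q ∧
    MeasureTheory.integral Q (fun ω => u (-(Z ω) - κ)) ≤ l), (κ : EReal)

/-- The worst-case shortfall risk of the decision `α` over the union ball. -/
noncomputable def worstCase {n N : ℕ} (nrm : Seminorm ℝ (Fin n → ℝ))
    (yhat : Fin N → Fin n → ℝ) (V : Set ((Fin N → ℝ) × ℝ)) (u : ℝ → ℝ) (l : ℝ)
    (α : Fin n → ℝ) : EReal :=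
  ⨆ Q ∈ unionBall nrm yhat V, shortfall u l Q (fun y => dotProduct y α)

/-- The pairs in `V` with nonnegative radius. -/
def plus {N : ℕ} (V : Set ((Fin N → ℝ) × ℝ)) : Set ((Fin N → ℝ) × ℝ) :=
  {x | x ∈ V ∧ 0 ≤ x.2}

/-- The constraint `∑ i, p i * u (-(yhat i)ᵀα - κ) + Lip(u) * δ * ‖α‖_* ≤ l`, `x = (p, δ)`. -/
def RegConstraint {n N : ℕ} (nrm : Seminorm ℝ (Fin n → ℝ)) (yhat : Fin N → Fin n → ℝ)
    (u : ℝ → ℝ) (l : ℝ) (α : Fin n → ℝ) (κ : ℝ) (x : (Fin N → ℝ) × ℝ) : Prop :=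
  ∑ i, x.1 i * u (-(dotProduct (yhat i) α) - κ) + lipConst u * x.2 * dualNorm nrm α ≤ l

/-- `sup` over `(p, δ) ∈ V₊` of the least `κ` that satisfies the constraint of `(p, δ)`. -/
noncomputable def supInf {n N : ℕ} (nrm : Seminorm ℝ (Fin n → ℝ))
    (yhat : Fin N → Fin n → ℝ) (V : Set ((Fin N → ℝ) × ℝ)) (u : ℝ → ℝ) (l : ℝ)
    (α : Fin n → ℝ) : EReal :=
  ⨆ x ∈ plus V, ⨅ (κ : ℝ) (_ : RegConstraint nrm yhat u l α κ x), (κ : EReal)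

/-- Feasible points `(α, κ)` of the robust problem: the constraint holds for all
`(p, δ) ∈ V₊`. -/
def robustFeasible {n N : ℕ} (nrm : Seminorm ℝ (Fin n → ℝ)) (yhat : Fin N → Fin n → ℝ)
    (V : Set ((Fin N → ℝ) × ℝ)) (u : ℝ → ℝ) (l : ℝ) (A : Set (Fin n → ℝ)) :
    Set ((Fin n → ℝ) × ℝ) :=
  {z | z.1 ∈ A ∧ ∀ x ∈ plus V, RegConstraint nrm yhat u l z.1 z.2 x}

open Classical in
/-- The convex indicator function of `S`: `0` on `S` and `+∞` elsewhere. -/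
noncomputable def indicatorFn {N : ℕ} (S : Set ((Fin N → ℝ) × ℝ)) (x : (Fin N → ℝ) × ℝ) :
    EReal :=
  if x ∈ S then 0 else ⊤

/-- The convex conjugate `g*(v) = sup_x (vᵀx - g x)` on `ℝ^{N+1} = ℝ^N × ℝ`. -/
noncomputable def convexConj {N : ℕ} (g : (Fin N → ℝ) × ℝ → EReal) (v : (Fin N → ℝ) × ℝ) :
    EReal :=
  ⨆ x : (Fin N → ℝ) × ℝ, ((dotProduct v.1 x.1 + v.2 * x.2 : ℝ) : EReal) - g x

/-- The conjugate of the indicator function of `S` is the support function of `S`. -/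
theorem convexConj_indicatorFn {N : ℕ} (S : Set ((Fin N → ℝ) × ℝ)) (v : (Fin N → ℝ) × ℝ) :
    convexConj (indicatorFn S) v =
      ⨆ x ∈ S, ((dotProduct v.1 x.1 + v.2 * x.2 : ℝ) : EReal) := by
  unfold convexConj
  refine iSup_congr fun x => ?_
  by_cases hx : x ∈ S
  · simp [indicatorFn, hx]
  · simp [indicatorFn, hx]

/-- Feasible points `(α, κ, v)`, `v ∈ ℝ^{N+1}`, of the convex program. -/
def programFeasible {n N : ℕ} (nrm : Seminorm ℝ (Fin n → ℝ)) (yhat : Fin N → Fin n → ℝ)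
    (V : Set ((Fin N → ℝ) × ℝ)) (u : ℝ → ℝ) (l : ℝ) (A : Set (Fin n → ℝ)) :
    Set ((Fin n → ℝ) × ℝ × ((Fin N → ℝ) × ℝ)) :=
  {z | z.1 ∈ A ∧ convexConj (indicatorFn (plus V)) z.2.2 ≤ (l : EReal) ∧
    (∀ i, u (-(dotProduct (yhat i) z.1) - z.2.1) ≤ z.2.2.1 i) ∧
    lipConst u * dualNorm nrm z.1 ≤ z.2.2.2}

end UnionBall

namespace UnionBall

open MeasureTheory Filter Topology

/-! ### Extended reals determined by their real upper bounds -/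

/-! An extended real is determined by its real upper bounds `κ`, so for fixed `α` it is enough to
show that the worst-case shortfall is at most `κ` exactly when the regularized constraint at `κ`
holds on `plus V` (`worstCase_le_coe_iff`). The expected loss is antitone and continuous in `κ`, so
a shortfall is at most `κ` iff the expected loss at `κ` is at most `l`. What remains is a two-sided
estimate of the expected loss over one ball.

Upper bound: the loss `y ↦ u(-yᵀα - κ)` is Lipschitz for the given norm with constant `Lip(u)‖α‖_*`;
integrate this along a nearly optimal coupling.

Lower bound (`sum_add_slope_le_of_forall_mem_otBall`): the worst case need not be attained, so move
a mass `δ/R` of the center by `-R y` with `‖y‖ ≤ 1` and let `R → ∞`. The mass removed vanishes, but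
by convexity the loss at the moved points grows at least at the rate of any chord slope of `u`.
Optimizing over chords gives `Lip(u)`, over `y` the dual norm.

The program with `v` then separates `(p, δ)` from the nonlinear terms: since `p` and `δ` are
nonnegative, enlarging `v` only tightens the constraint. -/

theorem eq_of_forall_le_coe_iff {a b : EReal} (h : ∀ κ : ℝ, a ≤ κ ↔ b ≤ κ) : a = b := by
  apply le_antisymm
  · exact EReal.le_of_forall_lt_iff_le.1 fun z hz => (h z).2 hz.le
  · exact EReal.le_of_forall_lt_iff_le.1 fun z hz => (h z).1 hz.le

theorem eq_iInf_coe_of_le (a : EReal) : a = ⨅ (κ : ℝ) (_ : a ≤ κ), (κ : EReal) := by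
  refine le_antisymm (le_iInf₂ fun _ h => h) ?_
  exact EReal.le_of_forall_lt_iff_le.1 fun z hz => iInf₂_le z hz.le

/-- Monotonicity makes every `κ > κ₀` admissible, and continuity from the right passes this on to
`κ₀`. No nonemptiness or lower bound is needed, so infinite infima are covered. -/
theorem iInf_coe_le_coe_iff {g : ℝ → ℝ} (hg : Antitone g) (hc : Continuous g) (l κ₀ : ℝ) :
    (⨅ (κ : ℝ) (_ : g κ ≤ l), (κ : EReal)) ≤ κ₀ ↔ g κ₀ ≤ l := by
  refine ⟨fun h => ?_, fun h => iInf₂_le κ₀ h⟩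
  have key : ∀ᶠ κ in 𝓝[>] κ₀, g κ ≤ l := by
    filter_upwards [self_mem_nhdsWithin] with κ hκ
    have h1 : (⨅ (κ : ℝ) (_ : g κ ≤ l), (κ : EReal)) < (κ : EReal) :=
      h.trans_lt (EReal.coe_lt_coe_iff.2 hκ)
    simp only [iInf_lt_iff] at h1
    obtain ⟨κ', h2, h3⟩ := h1
    exact (hg (EReal.coe_lt_coe_iff.1 h3).le).trans h2
  exact le_of_tendsto (hc.continuousWithinAt (s := Set.Ioi κ₀)) key

/-! ### The smallest Lipschitz constant -/

theorem lipConst_nonneg (u : ℝ → ℝ) : 0 ≤ lipConst u :=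
  Real.sInf_nonneg fun _ h => h.1

theorem abs_sub_le_lipConst_mul {u : ℝ → ℝ} (hu : ∃ K : NNReal, LipschitzWith K u) (x y : ℝ) :
    |u x - u y| ≤ lipConst u * |x - y| := by
  obtain ⟨K, hK⟩ := hu
  rcases eq_or_ne x y with rfl | hxy
  · simp
  have hpos : 0 < |x - y| := abs_pos.2 (sub_ne_zero.2 hxy)
  rw [← div_le_iff₀ hpos]
  refine le_csInf ⟨K, K.2, fun a b => ?_⟩ fun L hL => (div_le_iff₀ hpos).2 (hL.2 x y)
  simpa [Real.dist_eq] using hK.dist_le_mul a b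

/-- Monotonicity removes the absolute value, so upper bounds on chord slopes suffice; this is how a
bound valid for every chord becomes one with `Lip(u)`. -/
theorem lipConst_le_of_forall_slope_le {u : ℝ → ℝ} (hu : Monotone u) {L : ℝ}
    (h : ∀ x y, x < y → (u y - u x) / (y - x) ≤ L) : lipConst u ≤ L := by
  have hlt : ∀ x y, x < y → |u x - u y| ≤ L * |x - y| := fun x y hxy => by
    rw [abs_sub_comm, abs_sub_comm x y, abs_of_nonneg (sub_nonneg.2 (hu hxy.le)),
      abs_of_pos (sub_pos.2 hxy)]
    exact (div_le_iff₀ (sub_pos.2 hxy)).1 (h x y hxy)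
  refine csInf_le ⟨0, fun _ h => h.1⟩ ⟨?_, fun x y => ?_⟩
  · exact (div_nonneg (sub_nonneg.2 (hu zero_le_one)) (by norm_num)).trans (h 0 1 one_pos)
  · rcases lt_trichotomy x y with hxy | rfl | hxy
    · exact hlt x y hxy
    · simp
    · rw [abs_sub_comm, abs_sub_comm x y]
      exact hlt y x hxy

theorem continuous_of_exists_lipschitzWith {u : ℝ → ℝ} (hu : ∃ K : NNReal, LipschitzWith K u) :
    Continuous u :=
  hu.elim fun _ hK => hK.continuous

/-- Beyond `y`, a convex function lies above its chord through `x` and `y`. -/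
theorem chord_le_of_convexOn {u : ℝ → ℝ} (hu : ConvexOn ℝ Set.univ u) {x y z : ℝ} (hxy : x < y)
    (hyz : y < z) : u x + (u y - u x) / (y - x) * (z - x) ≤ u z := by
  have h := hu.secant_mono (a := x) (x := y) (y := z) trivial trivial trivial hxy.ne'
    (hxy.trans hyz).ne' hyz.le
  have h2 := (le_div_iff₀ (sub_pos.2 (hxy.trans hyz))).1 h
  linarith

/-! ### The dual norm -/

theorem continuous_seminorm {n : ℕ} (nrm : Seminorm ℝ (Fin n → ℝ)) : Continuous nrm :=
  nrm.convexOn.locallyLipschitz.continuous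

theorem exists_norm_le_mul_seminorm {n : ℕ} {nrm : Seminorm ℝ (Fin n → ℝ)}
    (hnrm : ∀ y, nrm y = 0 → y = 0) : ∃ C : ℝ, 0 ≤ C ∧ ∀ y, ‖y‖ ≤ C * nrm y := by
  -- The sphere is empty when `n = 0`; otherwise `nrm` has a positive minimum on it by compactness.
  rcases (Metric.sphere (0 : Fin n → ℝ) 1).eq_empty_or_nonempty with he | hne
  · refine ⟨0, le_rfl, fun y => ?_⟩
    by_contra hy
    have hy0 : ‖y‖ ≠ 0 := fun h => hy (by simp [h])
    have : ‖y‖⁻¹ • y ∈ Metric.sphere (0 : Fin n → ℝ) 1 := by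
      simp [norm_smul, hy0]
    simp [he] at this
  · obtain ⟨x, hx, hmin⟩ := (isCompact_sphere (0 : Fin n → ℝ) 1).exists_isMinOn hne
      (continuous_seminorm nrm).continuousOn
    have hx1 : ‖x‖ = 1 := by simpa using hx
    have hpos : 0 < nrm x := lt_of_le_of_ne (apply_nonneg nrm x) fun h => by
      simp [hnrm x h.symm] at hx1
    refine ⟨(nrm x)⁻¹, by positivity, fun y => ?_⟩
    rcases eq_or_ne y 0 with rfl | hy
    · simp
    have hy0 : 0 < ‖y‖ := norm_pos_iff.2 hy
    have hmem : ‖y‖⁻¹ • y ∈ Metric.sphere (0 : Fin n → ℝ) 1 := by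
      simp [norm_smul, hy0.ne']
    have h := hmin hmem
    simp only [Set.mem_ofPred_eq, map_smul_eq_mul, norm_inv, norm_norm] at h
    rw [inv_mul_eq_div, le_div_iff₀ hy0] at h
    rw [inv_mul_eq_div, le_div_iff₀ hpos]
    linarith

theorem abs_dotProduct_le_norm_mul {n : ℕ} (y α : Fin n → ℝ) :
    |dotProduct y α| ≤ ‖y‖ * ∑ i, |α i| := by
  rw [dotProduct, Finset.mul_sum]
  refine (Finset.abs_sum_le_sum_abs _ _).trans (Finset.sum_le_sum fun i _ => ?_)
  rw [abs_mul]
  exact mul_le_mul_of_nonneg_right (norm_le_pi_norm y i) (abs_nonneg _)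

section DualNorm

variable {n : ℕ} {nrm : Seminorm ℝ (Fin n → ℝ)}

/-- Definiteness of `nrm` is what makes the `sSup` in `dualNorm` a genuine supremum instead of a
default value. -/
theorem bddAbove_dualNorm (hnrm : ∀ y, nrm y = 0 → y = 0) (α : Fin n → ℝ) :
    BddAbove {r : ℝ | ∃ y : Fin n → ℝ, nrm y ≤ 1 ∧ r = dotProduct y α} := by
  obtain ⟨C, hC, h⟩ := exists_norm_le_mul_seminorm hnrm
  refine ⟨C * ∑ i, |α i|, ?_⟩
  rintro _ ⟨y, hy, rfl⟩
  refine (le_abs_self _).trans ((abs_dotProduct_le_norm_mul y α).trans ?_)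
  refine mul_le_mul_of_nonneg_right ((h y).trans ?_) (Finset.sum_nonneg fun _ _ => abs_nonneg _)
  exact mul_le_of_le_one_right hC hy

theorem dotProduct_le_dualNorm (hnrm : ∀ y, nrm y = 0 → y = 0) (α : Fin n → ℝ)
    {y : Fin n → ℝ} (hy : nrm y ≤ 1) : dotProduct y α ≤ dualNorm nrm α :=
  le_csSup (bddAbove_dualNorm hnrm α) ⟨y, hy, rfl⟩

theorem dualNorm_le {α : Fin n → ℝ} {c : ℝ} (h : ∀ y, nrm y ≤ 1 → dotProduct y α ≤ c) :
    dualNorm nrm α ≤ c := by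
  refine csSup_le ⟨0, 0, by simp, by simp⟩ ?_
  rintro _ ⟨y, hy, rfl⟩
  exact h y hy

theorem dualNorm_nonneg (hnrm : ∀ y, nrm y = 0 → y = 0) (α : Fin n → ℝ) :
    0 ≤ dualNorm nrm α := by
  simpa using dotProduct_le_dualNorm hnrm α (y := 0) (by simp)

theorem dotProduct_le_seminorm_mul_dualNorm (hnrm : ∀ y, nrm y = 0 → y = 0) (y α : Fin n → ℝ) :
    dotProduct y α ≤ nrm y * dualNorm nrm α := by
  rcases eq_or_ne (nrm y) 0 with h0 | h0
  · simp [hnrm y h0]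
  have hpos : 0 < nrm y := lt_of_le_of_ne (apply_nonneg nrm y) h0.symm
  have h := dotProduct_le_dualNorm hnrm α (y := (nrm y)⁻¹ • y) (by
    simp [map_smul_eq_mul, abs_of_pos hpos, h0])
  rwa [smul_dotProduct, smul_eq_mul, inv_mul_eq_div, div_le_iff₀ hpos, mul_comm] at h

theorem abs_dotProduct_le_seminorm_mul_dualNorm (hnrm : ∀ y, nrm y = 0 → y = 0)
    (y α : Fin n → ℝ) : |dotProduct y α| ≤ nrm y * dualNorm nrm α := by
  refine abs_le'.2 ⟨dotProduct_le_seminorm_mul_dualNorm hnrm y α, ?_⟩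
  simpa using dotProduct_le_seminorm_mul_dualNorm hnrm (-y) α

theorem dualNorm_add_smul_le (hnrm : ∀ y, nrm y = 0 → y = 0) (α β : Fin n → ℝ) {a b : ℝ}
    (ha : 0 ≤ a) (hb : 0 ≤ b) :
    dualNorm nrm (a • α + b • β) ≤ a * dualNorm nrm α + b * dualNorm nrm β := by
  refine dualNorm_le fun y hy => ?_
  rw [dotProduct_add, dotProduct_smul, dotProduct_smul, smul_eq_mul, smul_eq_mul]
  exact add_le_add (mul_le_mul_of_nonneg_left (dotProduct_le_dualNorm hnrm α hy) ha)
    (mul_le_mul_of_nonneg_left (dotProduct_le_dualNorm hnrm β hy) hb)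

end DualNorm

/-! ### Expectations under nearby distributions -/

/-- Integrate `f z.1 - f z.2 ≤ C * D z.1 z.2` against `π`. Finite cost also transfers integrability
of `f` from `P` to `Q`. -/
theorem integrable_and_integral_le_of_coupling {E : Type*} [MeasurableSpace E] {D : E → E → ℝ}
    (hD : Measurable fun z : E × E => D z.1 z.2) (hD0 : ∀ x y, 0 ≤ D x y) {f : E → ℝ}
    (hf : Measurable f) {C : ℝ} (hC : 0 ≤ C) (hfD : ∀ x y, |f x - f y| ≤ C * D x y)
    {P Q : Measure E} (hP : Integrable f P) {π : Measure (E × E)} (hQ : π.map Prod.fst = Q)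
    (hPπ : π.map Prod.snd = P) {d : ℝ} (hd : 0 ≤ d)
    (hcost : ∫⁻ z, ENNReal.ofReal (D z.1 z.2) ∂π ≤ ENNReal.ofReal d) :
    Integrable f Q ∧ ∫ y, f y ∂Q ≤ ∫ y, f y ∂P + C * d := by
  subst hQ hPπ
  have hDae : 0 ≤ᵐ[π] fun z : E × E => D z.1 z.2 := ae_of_all _ fun z => hD0 z.1 z.2
  have hDint : Integrable (fun z : E × E => D z.1 z.2) π := by
    refine ⟨hD.aestronglyMeasurable, ?_⟩
    rw [hasFiniteIntegral_iff_ofReal hDae]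
    exact hcost.trans_lt ENNReal.ofReal_lt_top
  have hDle : ∫ z, D z.1 z.2 ∂π ≤ d := by
    rw [integral_eq_lintegral_of_nonneg_ae hDae hD.aestronglyMeasurable]
    exact ENNReal.toReal_le_of_le_ofReal hd hcost
  have hsnd : Integrable (fun z : E × E => f z.2) π :=
    (integrable_map_measure hf.aestronglyMeasurable measurable_snd.aemeasurable).1 hP
  have hdiff : Integrable (fun z : E × E => f z.1 - f z.2) π := by
    refine (hDint.const_mul C).mono'
      ((hf.comp measurable_fst).sub (hf.comp measurable_snd)).aestronglyMeasurable
      (ae_of_all _ fun z => hfD z.1 z.2)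
  have hfst : Integrable (fun z : E × E => f z.1) π :=
    (hdiff.add hsnd).congr (ae_of_all _ fun z => sub_add_cancel (f z.1) (f z.2))
  refine ⟨(integrable_map_measure hf.aestronglyMeasurable measurable_fst.aemeasurable).2 hfst, ?_⟩
  rw [integral_map measurable_fst.aemeasurable hf.aestronglyMeasurable,
    integral_map measurable_snd.aemeasurable hf.aestronglyMeasurable]
  have h1 : ∫ z, f z.1 ∂π ≤ ∫ z, (f z.2 + C * D z.1 z.2) ∂π :=
    integral_mono hfst (hsnd.add (hDint.const_mul C)) fun z => by
      have := (le_abs_self _).trans (hfD z.1 z.2)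
      dsimp only
      linarith
  rw [integral_add hsnd (hDint.const_mul C), integral_const_mul] at h1
  exact h1.trans (by gcongr)

theorem integrable_and_integral_le_of_mem_otBall {E : Type*} [MeasurableSpace E] {D : E → E → ℝ}
    (hD : Measurable fun z : E × E => D z.1 z.2) (hD0 : ∀ x y, 0 ≤ D x y) {f : E → ℝ}
    (hf : Measurable f) {C : ℝ} (hC : 0 ≤ C) (hfD : ∀ x y, |f x - f y| ≤ C * D x y)
    {P Q : Measure E} (hP : Integrable f P) {δ : ℝ} (hδ : 0 ≤ δ) (hQ : Q ∈ otBall D P δ) :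
    Integrable f Q ∧ ∫ y, f y ∂Q ≤ ∫ y, f y ∂P + C * δ := by
  -- An optimal coupling is not assumed to exist: use one of cost below `δ + ε`, then let `ε → 0`.
  have key : ∀ ε : ℝ, 0 < ε → Integrable f Q ∧ ∫ y, f y ∂Q ≤ ∫ y, f y ∂P + C * (δ + ε) := by
    intro ε hε
    have h1 : otCost D Q P < ENNReal.ofReal (δ + ε) := by
      have h2 : (otCost D Q P : EReal) < (ENNReal.ofReal (δ + ε) : EReal) := by
        rw [EReal.coe_ennreal_ofReal, max_eq_left (by positivity)]
        exact hQ.2.trans_lt (EReal.coe_lt_coe_iff.2 (by linarith))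
      exact EReal.coe_ennreal_lt_coe_ennreal_iff.1 h2
    simp only [otCost, iInf_lt_iff] at h1
    obtain ⟨π, ⟨hπ1, hπ2⟩, hπ⟩ := h1
    exact integrable_and_integral_le_of_coupling hD hD0 hf hC hfD hP hπ1 hπ2 (by positivity) hπ.le
  refine ⟨(key 1 one_pos).1, ?_⟩
  have hlim : Tendsto (fun ε : ℝ => ∫ y, f y ∂P + C * (δ + ε)) (𝓝[>] 0)
      (𝓝 (∫ y, f y ∂P + C * (δ + 0))) :=
    (Continuous.tendsto (by fun_prop) 0).mono_left nhdsWithin_le_nhds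
  rw [add_zero] at hlim
  exact ge_of_tendsto hlim (by filter_upwards [self_mem_nhdsWithin] with ε hε using (key ε hε).2)

/-! ### Discrete centers and their perturbations -/

section Center

variable {n N : ℕ}

theorem integrable_center (yhat : Fin N → Fin n → ℝ) (p : Fin N → ℝ) (f : (Fin n → ℝ) → ℝ) :
    Integrable f (center yhat p) := by
  refine integrable_finsetSum_measure.2 fun i _ => ?_
  exact (integrable_dirac (by simp)).smul_measure ENNReal.ofReal_ne_top

theorem integral_center (yhat : Fin N → Fin n → ℝ) {p : Fin N → ℝ} (hp : ∀ i, 0 ≤ p i)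
    (f : (Fin n → ℝ) → ℝ) : ∫ y, f y ∂(center yhat p) = ∑ i, p i * f (yhat i) := by
  rw [center, integral_finsetSum_measure fun i _ =>
    (integrable_dirac (by simp)).smul_measure ENNReal.ofReal_ne_top]
  simp [integral_smul_measure, ENNReal.toReal_ofReal (hp _)]

theorem isProbabilityMeasure_center (yhat : Fin N → Fin n → ℝ) {p : Fin N → ℝ}
    (hp : p ∈ stdSimplex ℝ (Fin N)) : IsProbabilityMeasure (center yhat p) := by
  constructor
  simp only [center, Measure.coe_finsetSum, Finset.sum_apply, Measure.smul_apply, smul_eq_mul,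
    measure_univ, mul_one]
  rw [← ENNReal.ofReal_sum_of_nonneg fun i _ => hp.1 i, hp.2, ENNReal.ofReal_one]

/-- Moving the fraction `ε` of each atom of the center in the direction `w`. -/
noncomputable def shifted (yhat : Fin N → Fin n → ℝ) (p : Fin N → ℝ) (ε : ℝ) (w : Fin n → ℝ) :
    Measure (Fin n → ℝ) :=
  ENNReal.ofReal (1 - ε) • center yhat p +
    ENNReal.ofReal ε • center (fun i => yhat i + w) p

theorem integral_shifted (yhat : Fin N → Fin n → ℝ) {p : Fin N → ℝ} (hp : ∀ i, 0 ≤ p i) {ε : ℝ}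
    (hε0 : 0 ≤ ε) (hε1 : ε ≤ 1) (w : Fin n → ℝ) (f : (Fin n → ℝ) → ℝ) :
    ∫ y, f y ∂(shifted yhat p ε w) =
      (1 - ε) * ∑ i, p i * f (yhat i) + ε * ∑ i, p i * f (yhat i + w) := by
  rw [shifted, integral_add_measure
    ((integrable_center yhat p f).smul_measure ENNReal.ofReal_ne_top)
    ((integrable_center _ p f).smul_measure ENNReal.ofReal_ne_top),
    integral_smul_measure, integral_smul_measure, integral_center _ hp, integral_center _ hp,
    ENNReal.toReal_ofReal hε0, ENNReal.toReal_ofReal (sub_nonneg.2 hε1)]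
  rfl

theorem map_center {E : Type*} [MeasurableSpace E] (g : (Fin n → ℝ) → E)
    (hg : Measurable g) (yhat : Fin N → Fin n → ℝ) (p : Fin N → ℝ) :
    (center yhat p).map g = ∑ i, ENNReal.ofReal (p i) • Measure.dirac (g (yhat i)) := by
  rw [center, Measure.map_finset_sum hg.aemeasurable]
  simp [Measure.map_smul, Measure.map_dirac' hg]

theorem shifted_mem_otBall (nrm : Seminorm ℝ (Fin n → ℝ)) (yhat : Fin N → Fin n → ℝ)
    {p : Fin N → ℝ} (hp : p ∈ stdSimplex ℝ (Fin N)) {ε δ : ℝ} (hε0 : 0 ≤ ε) (hε1 : ε ≤ 1)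
    {w : Fin n → ℝ} (hw : ε * nrm w ≤ δ) :
    shifted yhat p ε w ∈ otBall (fun y₁ y₂ => nrm (y₁ - y₂)) (center yhat p) δ := by
  have hsum : ENNReal.ofReal (1 - ε) + ENNReal.ofReal ε = 1 := by
    rw [← ENNReal.ofReal_add (sub_nonneg.2 hε1) hε0]
    simp
  have := isProbabilityMeasure_center yhat hp
  have hshift : Measurable fun y : Fin n → ℝ => y + w := by fun_prop
  have hmapw : (center yhat p).map (fun y => y + w) = center (fun i => yhat i + w) p :=
    map_center _ hshift yhat p
  have hdiag : Measurable fun y : Fin n → ℝ => (y, y) := by fun_prop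
  have hmove : Measurable fun y : Fin n → ℝ => (y + w, y) := by fun_prop
  refine ⟨⟨?_⟩, ?_⟩
  · have := isProbabilityMeasure_center (fun i => yhat i + w) hp
    simp [shifted, hsum]
  -- The coupling leaves the fraction `1 - ε` on the diagonal and translates the rest by `w`, at
  -- total cost `ε * nrm w`.
  set π : Measure ((Fin n → ℝ) × (Fin n → ℝ)) :=
    ENNReal.ofReal (1 - ε) • (center yhat p).map (fun y => (y, y)) +
      ENNReal.ofReal ε • (center yhat p).map (fun y => (y + w, y)) with hπ
  have h1 : π.map Prod.fst = shifted yhat p ε w := by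
    rw [hπ, Measure.map_add _ _ measurable_fst, Measure.map_smul, Measure.map_smul,
      Measure.map_map measurable_fst hdiag, Measure.map_map measurable_fst hmove, shifted, ← hmapw]
    simp [Function.comp_def]
  have h2 : π.map Prod.snd = center yhat p := by
    rw [hπ, Measure.map_add _ _ measurable_snd, Measure.map_smul, Measure.map_smul,
      Measure.map_map measurable_snd hdiag, Measure.map_map measurable_snd hmove]
    simp [Function.comp_def, ← add_smul, hsum]
  have hmeas : Measurable fun z : (Fin n → ℝ) × (Fin n → ℝ) =>
      ENNReal.ofReal (nrm (z.1 - z.2)) :=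
    (((continuous_seminorm nrm).comp (continuous_fst.sub continuous_snd)).measurable).ennreal_ofReal
  have hle : otCost (fun y₁ y₂ => nrm (y₁ - y₂)) (shifted yhat p ε w) (center yhat p) ≤
      ENNReal.ofReal δ := by
    refine (iInf₂_le π ⟨h1, h2⟩).trans ?_
    rw [hπ, lintegral_add_measure, lintegral_smul_measure, lintegral_smul_measure,
      lintegral_map hmeas hdiag, lintegral_map hmeas hmove]
    simp only [sub_self, map_zero, ENNReal.ofReal_zero, lintegral_zero, mul_zero, zero_add,
      add_sub_cancel_left, lintegral_const, measure_univ, mul_one, smul_eq_mul]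
    rw [← ENNReal.ofReal_mul hε0]
    exact ENNReal.ofReal_le_ofReal hw
  have hδ : 0 ≤ δ := (mul_nonneg hε0 (apply_nonneg nrm w)).trans hw
  calc ((otCost _ _ _ : ENNReal) : EReal) ≤ ((ENNReal.ofReal δ : ENNReal) : EReal) :=
        EReal.coe_ennreal_le_coe_ennreal_iff.2 hle
    _ = (δ : EReal) := by rw [EReal.coe_ennreal_ofReal, max_eq_left hδ]

end Center

/-! ### The worst-case expectation over a ball -/

section WorstCase

variable {n N : ℕ} {nrm : Seminorm ℝ (Fin n → ℝ)} {yhat : Fin N → Fin n → ℝ} {u : ℝ → ℝ}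

theorem abs_loss_sub_loss_le (hnrm : ∀ y, nrm y = 0 → y = 0)
    (hu : ∃ K : NNReal, LipschitzWith K u) (α : Fin n → ℝ) (κ : ℝ) (x y : Fin n → ℝ) :
    |u (-(dotProduct x α) - κ) - u (-(dotProduct y α) - κ)| ≤
      lipConst u * dualNorm nrm α * nrm (x - y) := by
  refine (abs_sub_le_lipConst_mul hu _ _).trans ?_
  rw [mul_assoc]
  refine mul_le_mul_of_nonneg_left ?_ (lipConst_nonneg u)
  have h : -(dotProduct x α) - κ - (-(dotProduct y α) - κ) = -dotProduct (x - y) α := by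
    rw [sub_dotProduct]
    ring
  rw [h, abs_neg, mul_comm]
  exact abs_dotProduct_le_seminorm_mul_dualNorm hnrm _ _

theorem continuous_loss (hu : ∃ K : NNReal, LipschitzWith K u) (α : Fin n → ℝ) (κ : ℝ) :
    Continuous fun y : Fin n → ℝ => u (-(dotProduct y α) - κ) := by
  have := continuous_of_exists_lipschitzWith hu
  unfold dotProduct
  fun_prop

theorem integrable_and_integral_loss_le (hnrm : ∀ y, nrm y = 0 → y = 0)
    (hu : ∃ K : NNReal, LipschitzWith K u) (α : Fin n → ℝ) (κ : ℝ) {p : Fin N → ℝ}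
    (hp : ∀ i, 0 ≤ p i) {δ : ℝ} (hδ : 0 ≤ δ) {Q : Measure (Fin n → ℝ)}
    (hQ : Q ∈ otBall (fun y₁ y₂ => nrm (y₁ - y₂)) (center yhat p) δ) :
    Integrable (fun y => u (-(dotProduct y α) - κ)) Q ∧
      ∫ y, u (-(dotProduct y α) - κ) ∂Q ≤
        ∑ i, p i * u (-(dotProduct (yhat i) α) - κ) + lipConst u * δ * dualNorm nrm α := by
  have hD : Measurable fun z : (Fin n → ℝ) × (Fin n → ℝ) => nrm (z.1 - z.2) :=
    ((continuous_seminorm nrm).comp (continuous_fst.sub continuous_snd)).measurable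
  have h := integrable_and_integral_le_of_mem_otBall (D := fun y₁ y₂ => nrm (y₁ - y₂)) hD
    (fun _ _ => apply_nonneg nrm _) (continuous_loss hu α κ).measurable
    (mul_nonneg (lipConst_nonneg u) (dualNorm_nonneg hnrm α))
    (abs_loss_sub_loss_le hnrm hu α κ) (integrable_center yhat p _) hδ hQ
  rw [integral_center _ hp] at h
  exact ⟨h.1, h.2.trans_eq (by ring)⟩

/-- If every distribution in the ball satisfies the risk bound, then so does the regularized
expectation with the dual norm replaced by `yᵀα` for a `y` in the unit ball. -/
theorem sum_add_slope_le_of_forall_mem_otBall (hu : ConvexOn ℝ Set.univ u)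
    {α : Fin n → ℝ} {κ l : ℝ} {p : Fin N → ℝ} (hp : p ∈ stdSimplex ℝ (Fin N)) {δ : ℝ}
    (hδ : 0 ≤ δ)
    (h : ∀ Q ∈ otBall (fun y₁ y₂ => nrm (y₁ - y₂)) (center yhat p) δ,
      ∫ y, u (-(dotProduct y α) - κ) ∂Q ≤ l)
    {y : Fin n → ℝ} (hy : nrm y ≤ 1) (ht : 0 < dotProduct y α) {a b : ℝ} (hab : a < b) :
    ∑ i, p i * u (-(dotProduct (yhat i) α) - κ) +
      (u b - u a) / (b - a) * δ * dotProduct y α ≤ l := by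
  set t := dotProduct y α
  set s := (u b - u a) / (b - a)
  set c : Fin N → ℝ := fun i => -(dotProduct (yhat i) α) - κ with hc
  set G := ∑ i, p i * u (c i)
  -- `H` averages the line through `(a, u a)` and `(b, u b)` at the unshifted arguments `c i`.
  set H := ∑ i, p i * (u a + s * (c i - a))
  have hev : ∀ᶠ R : ℝ in atTop, G + δ * R⁻¹ * (H - G) + s * δ * t ≤ l := by
    -- For large `R` every moved argument lies beyond `b`, where `u` dominates that line.
    have hfar : ∀ᶠ R : ℝ in atTop, ∀ i, b < c i + R * t := by
      refine eventually_all.2 fun i => ?_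
      exact (tendsto_atTop_add_const_left _ _
        (tendsto_id.atTop_mul_const ht)).eventually_gt_atTop b
    filter_upwards [hfar, eventually_ge_atTop δ, eventually_gt_atTop 0] with R hR hRδ hR0
    have hε0 : 0 ≤ δ * R⁻¹ := by positivity
    have hε1 : δ * R⁻¹ ≤ 1 := by
      rw [← div_eq_mul_inv]
      exact (div_le_one hR0).2 hRδ
    have hRR : R⁻¹ * R = 1 := inv_mul_cancel₀ hR0.ne'
    have hw : δ * R⁻¹ * nrm (-(R • y)) ≤ δ := by
      rw [map_neg_eq_map, map_smul_eq_mul, Real.norm_of_nonneg hR0.le]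
      calc δ * R⁻¹ * (R * nrm y) = δ * nrm y * (R⁻¹ * R) := by ring
        _ ≤ δ := by
          rw [hRR, mul_one]
          exact mul_le_of_le_one_right hδ hy
    have hQ := h _ (shifted_mem_otBall nrm yhat hp hε0 hε1 hw)
    rw [integral_shifted _ hp.1 hε0 hε1] at hQ
    have hcR : ∀ i, -(dotProduct (yhat i + -(R • y)) α) - κ = c i + R * t := fun i => by
      simp only [add_dotProduct, neg_dotProduct, smul_dotProduct, smul_eq_mul, hc]
      ring
    simp only [hcR] at hQ
    have hlow : H + s * (R * t) ≤ ∑ i, p i * u (c i + R * t) := by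
      have hone : s * (R * t) = ∑ i, p i * (s * (R * t)) := by
        rw [← Finset.sum_mul, hp.2, one_mul]
      rw [hone, ← Finset.sum_add_distrib]
      refine Finset.sum_le_sum fun i _ => ?_
      rw [← mul_add]
      refine mul_le_mul_of_nonneg_left ?_ (hp.1 i)
      exact le_trans (le_of_eq (by ring)) (chord_le_of_convexOn hu hab (hR i))
    have hlow' := mul_le_mul_of_nonneg_left hlow hε0
    calc G + δ * R⁻¹ * (H - G) + s * δ * t
        = (1 - δ * R⁻¹) * G + (δ * R⁻¹ * H + s * δ * t * (R⁻¹ * R)) := by rw [hRR]; ring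
      _ = (1 - δ * R⁻¹) * G + δ * R⁻¹ * (H + s * (R * t)) := by ring
      _ ≤ l := (add_le_add_right hlow' _).trans hQ
  -- Only the correction `δ * R⁻¹ * (H - G)` depends on `R`, and it vanishes.
  have hlim : Tendsto (fun R : ℝ => G + δ * R⁻¹ * (H - G) + s * δ * t) atTop
      (𝓝 (G + δ * 0 * (H - G) + s * δ * t)) :=
    (((tendsto_inv_atTop_zero.const_mul δ).mul_const (H - G)).const_add G).add_const _
  simpa using le_of_tendsto hlim hev

theorem center_mem_otBall (nrm : Seminorm ℝ (Fin n → ℝ)) (yhat : Fin N → Fin n → ℝ)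
    {p : Fin N → ℝ} (hp : p ∈ stdSimplex ℝ (Fin N)) {δ : ℝ} (hδ : 0 ≤ δ) :
    center yhat p ∈ otBall (fun y₁ y₂ => nrm (y₁ - y₂)) (center yhat p) δ := by
  have h := shifted_mem_otBall nrm yhat hp le_rfl zero_le_one (w := 0) (δ := δ) (by simpa using hδ)
  simpa [shifted] using h

theorem sum_add_lipConst_le_of_forall_mem_otBall (hu : ConvexOn ℝ Set.univ u)
    (hu_mono : Monotone u) {α : Fin n → ℝ} {κ l : ℝ} {p : Fin N → ℝ}
    (hp : p ∈ stdSimplex ℝ (Fin N)) {δ : ℝ} (hδ : 0 ≤ δ)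
    (h : ∀ Q ∈ otBall (fun y₁ y₂ => nrm (y₁ - y₂)) (center yhat p) δ,
      ∫ y, u (-(dotProduct y α) - κ) ∂Q ≤ l) :
    ∑ i, p i * u (-(dotProduct (yhat i) α) - κ) + lipConst u * δ * dualNorm nrm α ≤ l := by
  have hcenter : ∑ i, p i * u (-(dotProduct (yhat i) α) - κ) ≤ l := by
    have h0 := h _ (center_mem_otBall nrm yhat hp hδ)
    rwa [integral_center _ hp.1] at h0
  -- If `Lip(u) * δ = 0` the penalty vanishes and the center itself gives the bound; otherwise
  -- division isolates the dual norm.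
  rcases (mul_nonneg (lipConst_nonneg u) hδ).eq_or_lt with h0 | hpos
  · simpa [← h0] using hcenter
  have hδ' : 0 < δ := hδ.lt_of_ne fun h0 => by simp [← h0] at hpos
  rw [← le_sub_iff_add_le', ← le_div_iff₀' hpos]
  refine dualNorm_le fun y hy => ?_
  rw [le_div_iff₀' hpos]
  rcases le_or_gt (dotProduct y α) 0 with ht | ht
  · exact (mul_nonpos_of_nonneg_of_nonpos hpos.le ht).trans (sub_nonneg.2 hcenter)
  have hL : lipConst u ≤
      (l - ∑ i, p i * u (-(dotProduct (yhat i) α) - κ)) / (δ * dotProduct y α) := by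
    refine lipConst_le_of_forall_slope_le hu_mono fun a b hab => ?_
    rw [le_div_iff₀ (mul_pos hδ' ht), ← mul_assoc]
    exact le_sub_iff_add_le'.2 (sum_add_slope_le_of_forall_mem_otBall hu hp hδ h hy ht hab)
  rw [le_div_iff₀ (mul_pos hδ' ht), ← mul_assoc] at hL
  exact hL

/-! ### Epigraph forms -/

variable {V : Set ((Fin N → ℝ) × ℝ)} {l : ℝ}

/-- The expected loss inherits from `u` both monotonicity and the Lipschitz constant in `κ`, so the
infimum criterion for antitone continuous functions applies. -/
theorem shortfall_le_coe_iff (hu : ∃ K : NNReal, LipschitzWith K u) (hu_mono : Monotone u)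
    {Ω : Type*} [MeasurableSpace Ω] {Q : Measure Ω} [IsProbabilityMeasure Q] {Z : Ω → ℝ}
    (hint : ∀ κ : ℝ, Integrable (fun ω => u (-(Z ω) - κ)) Q) (κ : ℝ) :
    shortfall u l Q Z ≤ κ ↔ ∫ ω, u (-(Z ω) - κ) ∂Q ≤ l := by
  have hg : Antitone fun κ : ℝ => ∫ ω, u (-(Z ω) - κ) ∂Q := fun a b hab =>
    integral_mono (hint b) (hint a) fun ω => hu_mono (by linarith)
  have hc : Continuous fun κ : ℝ => ∫ ω, u (-(Z ω) - κ) ∂Q := by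
    obtain ⟨K, hK⟩ := hu
    refine (LipschitzWith.of_dist_le_mul (K := K) fun a b => ?_).continuous
    rw [Real.dist_eq, ← integral_sub (hint a) (hint b)]
    have hb := norm_integral_le_of_norm_le_const (μ := Q) (C := K * dist a b)
      (f := fun ω => u (-(Z ω) - a) - u (-(Z ω) - b)) (ae_of_all _ fun ω => by
        rw [← dist_eq_norm]
        refine (hK.dist_le_mul _ _).trans_eq ?_
        rw [dist_sub_left])
    simpa using hb
  rw [← iInf_coe_le_coe_iff hg hc]
  simp [shortfall, hint]

theorem worstCase_le_coe_iff (hnrm : ∀ y, nrm y = 0 → y = 0)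
    (hV : ∀ x ∈ V, x.1 ∈ stdSimplex ℝ (Fin N)) (hu_conv : ConvexOn ℝ Set.univ u)
    (hu_mono : Monotone u) (hu : ∃ K : NNReal, LipschitzWith K u) (α : Fin n → ℝ) (κ : ℝ) :
    worstCase nrm yhat V u l α ≤ κ ↔ ∀ x ∈ plus V, RegConstraint nrm yhat u l α κ x := by
  have hsf : ∀ x ∈ plus V, ∀ Q ∈ otBall (fun y₁ y₂ => nrm (y₁ - y₂)) (center yhat x.1) x.2,
      (shortfall u l Q (fun y => dotProduct y α) ≤ κ ↔
        ∫ y, u (-(dotProduct y α) - κ) ∂Q ≤ l) := fun x hx Q hQ => by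
    have := hQ.1
    exact shortfall_le_coe_iff hu hu_mono (fun κ' =>
      (integrable_and_integral_loss_le hnrm hu α κ' (hV x hx.1).1 hx.2 hQ).1) κ
  simp only [worstCase, iSup_le_iff, unionBall, Set.mem_iUnion]
  constructor
  · intro h x hx
    exact sum_add_lipConst_le_of_forall_mem_otBall hu_conv hu_mono (hV x hx.1) hx.2 fun Q hQ =>
      (hsf x hx Q hQ).1 (h Q ⟨x, hx.1, hQ⟩)
  · rintro h Q ⟨x, hxV, hQ⟩
    -- A ball with a member has nonnegative radius because transport costs are nonnegative; this
    -- replaces `V` by `plus V`.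
    have hx0 : 0 ≤ x.2 :=
      EReal.coe_nonneg.1 ((EReal.coe_ennreal_nonneg _).trans hQ.2)
    exact (hsf x ⟨hxV, hx0⟩ Q hQ).2
      ((integrable_and_integral_loss_le hnrm hu α κ (hV x hxV).1 hx0 hQ).2.trans (h x ⟨hxV, hx0⟩))

theorem supInf_le_coe_iff (hV : ∀ x ∈ V, x.1 ∈ stdSimplex ℝ (Fin N)) (hu_mono : Monotone u)
    (hu : ∃ K : NNReal, LipschitzWith K u) (α : Fin n → ℝ) (κ : ℝ) :
    supInf nrm yhat V u l α ≤ κ ↔ ∀ x ∈ plus V, RegConstraint nrm yhat u l α κ x := by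
  simp only [supInf, iSup_le_iff]
  refine forall₂_congr fun x hx => ?_
  refine iInf_coe_le_coe_iff (g := fun κ => ∑ i, x.1 i * u (-(dotProduct (yhat i) α) - κ) +
    lipConst u * x.2 * dualNorm nrm α) (fun a b hab => ?_) ?_ l κ
  · refine add_le_add_left (Finset.sum_le_sum fun i _ => ?_) _
    exact mul_le_mul_of_nonneg_left (hu_mono (by linarith)) ((hV x hx.1).1 i)
  · have := continuous_of_exists_lipschitzWith hu
    fun_prop

theorem convexConj_indicatorFn_le_coe_iff (S : Set ((Fin N → ℝ) × ℝ)) (v : (Fin N → ℝ) × ℝ) :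
    convexConj (indicatorFn S) v ≤ (l : EReal) ↔
      ∀ x ∈ S, dotProduct v.1 x.1 + v.2 * x.2 ≤ l := by
  rw [convexConj_indicatorFn]
  simp only [iSup_le_iff, EReal.coe_le_coe_iff]

/-! ### The robust problem and the convex program -/

variable {A : Set (Fin n → ℝ)}

theorem mem_robustFeasible_iff_exists (hV : ∀ x ∈ V, x.1 ∈ stdSimplex ℝ (Fin N))
    (α : Fin n → ℝ) (κ : ℝ) :
    (α, κ) ∈ robustFeasible nrm yhat V u l A ↔
      ∃ v : (Fin N → ℝ) × ℝ, (α, κ, v) ∈ programFeasible nrm yhat V u l A := by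
  simp only [robustFeasible, programFeasible, Set.mem_ofPred_eq, convexConj_indicatorFn_le_coe_iff,
    RegConstraint]
  constructor
  · rintro ⟨hα, h⟩
    -- The least admissible `v`: all its lower bounds hold with equality.
    refine ⟨(fun i => u (-(dotProduct (yhat i) α) - κ), lipConst u * dualNorm nrm α), hα,
      fun x hx => le_of_eq_of_le ?_ (h x hx), fun i => le_rfl, le_rfl⟩
    rw [dotProduct_comm, dotProduct]
    ring
  · rintro ⟨v, hα, hv, hv1, hv2⟩
    refine ⟨hα, fun x hx => le_trans ?_ (hv x hx)⟩
    rw [dotProduct_comm, dotProduct]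
    refine add_le_add (Finset.sum_le_sum fun i _ =>
      mul_le_mul_of_nonneg_left (hv1 i) ((hV x hx.1).1 i)) ?_
    rw [mul_right_comm]
    exact mul_le_mul_of_nonneg_right hv2 hx.2

/-- The support function is a supremum of linear functions of `v`, `u` is composed with a map affine
in `(α, κ)`, and the dual norm is convex with the nonnegative factor `Lip(u)`. -/
theorem convex_programFeasible (hnrm : ∀ y, nrm y = 0 → y = 0)
    (hu_conv : ConvexOn ℝ Set.univ u) (hA : Convex ℝ A) :
    Convex ℝ (programFeasible nrm yhat V u l A) := by
  rintro ⟨α, κ, v⟩ ⟨hα, hv, hv1, hv2⟩ ⟨β, η, w⟩ ⟨hβ, hw, hw1, hw2⟩ a b ha hb hab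
  dsimp only at hα hv hv1 hv2 hβ hw hw1 hw2
  rw [convexConj_indicatorFn_le_coe_iff] at hv hw
  refine ⟨hA hα hβ ha hb hab, ?_, fun i => ?_, ?_⟩
  · rw [convexConj_indicatorFn_le_coe_iff]
    intro x hx
    have h1 := mul_le_mul_of_nonneg_left (hv x hx) ha
    have h2 := mul_le_mul_of_nonneg_left (hw x hx) hb
    have hl : a * l + b * l = l := by rw [← add_mul, hab, one_mul]
    simp only [Prod.snd_add, Prod.fst_add, Prod.smul_fst, Prod.smul_snd, add_dotProduct,
      smul_dotProduct, smul_eq_mul]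
    linarith
  · have h := hu_conv.2 (Set.mem_univ (-(dotProduct (yhat i) α) - κ))
      (Set.mem_univ (-(dotProduct (yhat i) β) - η)) ha hb hab
    have h1 := mul_le_mul_of_nonneg_left (hv1 i) ha
    have h2 := mul_le_mul_of_nonneg_left (hw1 i) hb
    have harg : -(dotProduct (yhat i) (a • α + b • β)) - (a * κ + b * η) =
        a • (-(dotProduct (yhat i) α) - κ) + b • (-(dotProduct (yhat i) β) - η) := by
      simp only [dotProduct_add, dotProduct_smul, smul_eq_mul]
      ring
    simp only [Prod.fst_add, Prod.smul_fst, smul_eq_mul, Pi.add_apply,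
      Pi.smul_apply, Prod.smul_mk, Prod.mk_add_mk]
    rw [harg]
    simp only [smul_eq_mul] at h ⊢
    linarith
  · have h := mul_le_mul_of_nonneg_left (dualNorm_add_smul_le hnrm α β ha hb) (lipConst_nonneg u)
    have h1 := mul_le_mul_of_nonneg_left hv2 ha
    have h2 := mul_le_mul_of_nonneg_left hw2 hb
    simp only [Prod.snd_add, Prod.smul_snd, smul_eq_mul, Prod.smul_mk, Prod.mk_add_mk]
    linarith

end WorstCase

end UnionBall

theorem mainTheorem10 {n N : ℕ}
    (nrm : Seminorm ℝ (Fin n → ℝ)) (hnrm : ∀ y, nrm y = 0 → y = 0)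
    (yhat : Fin N → Fin n → ℝ)
    (V : Set ((Fin N → ℝ) × ℝ)) (hVconv : Convex ℝ V)
    (hVsimplex : ∀ x ∈ V, x.1 ∈ stdSimplex ℝ (Fin N))
    (A : Set (Fin n → ℝ))
    (u : ℝ → ℝ) (hu_conv : ConvexOn ℝ Set.univ u) (hu_mono : Monotone u)
    (hu_lip : ∃ K : NNReal, LipschitzWith K u)
    (l : ℝ) (hl : l ∈ interior (Set.range u)) :
    -- equality of the optimal values of the four problems
    (⨅ α ∈ A, UnionBall.worstCase nrm yhat V u l α)
        = (⨅ α ∈ A, UnionBall.supInf nrm yhat V u l α) ∧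
    (⨅ α ∈ A, UnionBall.supInf nrm yhat V u l α)
        = (⨅ z ∈ UnionBall.robustFeasible nrm yhat V u l A, (z.2 : EReal)) ∧
    (⨅ z ∈ UnionBall.robustFeasible nrm yhat V u l A, (z.2 : EReal))
        = (⨅ z ∈ UnionBall.programFeasible nrm yhat V u l A, (z.2.1 : EReal)) ∧
    -- decision by decision, the first two objectives agree
    (∀ α ∈ A, UnionBall.worstCase nrm yhat V u l α = UnionBall.supInf nrm yhat V u l α) ∧
    -- the robust problem is the epigraph form of the original problem
    (∀ (α : Fin n → ℝ) (κ : ℝ), (α, κ) ∈ UnionBall.robustFeasible nrm yhat V u l A ↔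
      α ∈ A ∧ UnionBall.worstCase nrm yhat V u l α ≤ (κ : EReal)) ∧
    -- the feasible set of the program projects onto that of the robust problem
    (∀ (α : Fin n → ℝ) (κ : ℝ), (α, κ) ∈ UnionBall.robustFeasible nrm yhat V u l A ↔
      ∃ v : (Fin N → ℝ) × ℝ, (α, κ, v) ∈ UnionBall.programFeasible nrm yhat V u l A) ∧
    -- the program is convex
    (Convex ℝ A → Convex ℝ (UnionBall.programFeasible nrm yhat V u l A)) := by
  have hw := fun α κ => UnionBall.worstCase_le_coe_iff (yhat := yhat) (l := l) hnrm hVsimplex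
    hu_conv hu_mono hu_lip α κ
  have hs := fun α κ => UnionBall.supInf_le_coe_iff (nrm := nrm) (yhat := yhat) (l := l) hVsimplex
    hu_mono hu_lip α κ
  have heq : ∀ α, UnionBall.worstCase nrm yhat V u l α = UnionBall.supInf nrm yhat V u l α :=
    fun α => UnionBall.eq_of_forall_le_coe_iff fun κ => (hw α κ).trans (hs α κ).symm
  have hproj := fun α κ => UnionBall.mem_robustFeasible_iff_exists (nrm := nrm) (yhat := yhat)
    (u := u) (l := l) (A := A) hVsimplex α κ
  refine ⟨by simp only [heq], ?_, ?_, fun α _ => heq α, fun α κ => ?_, hproj,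
    UnionBall.convex_programFeasible hnrm hu_conv⟩
  · apply le_antisymm
    · refine le_iInf₂ fun z hz => (iInf₂_le z.1 hz.1).trans ?_
      exact (hs z.1 z.2).2 hz.2
    · refine le_iInf₂ fun α hα => ?_
      -- Writing the value as the infimum of its real upper bounds also handles `⊤` (no feasible
      -- `κ`) and `⊥` (every `κ` feasible).
      rw [UnionBall.eq_iInf_coe_of_le (UnionBall.supInf nrm yhat V u l α)]
      refine le_iInf₂ fun κ hκ => ?_
      exact iInf₂_le (α, κ) ⟨hα, (hs α κ).1 hκ⟩
  · apply le_antisymm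
    · exact le_iInf₂ fun z hz => iInf₂_le (z.1, z.2.1) ((hproj z.1 z.2.1).2 ⟨z.2.2, hz⟩)
    · refine le_iInf₂ fun z hz => ?_
      obtain ⟨v, hv⟩ := (hproj z.1 z.2).1 hz
      exact iInf₂_le (z.1, z.2, v) hv
  · exact and_congr_right fun _ => (hw α κ).symm
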